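/- Composition of morphisms is written from left to right. **Normal categories.** A *category with subobjects* is a small category $\mathcal C$ with a subcategory $\mathcal P$ (whose morphisms are called inclusions, and for which we write $a\preceq b$ and $j(a,b)$ if there is an inclusion $a\to b$) such that $\mathcal P$ has all objects of $\mathcal C$ and is a strict preorder, every inclusion is a monomorphism of $\mathcal C$, and $h$ is an inclusion whenever $g$ and $hg$ are. A *retraction* is a morphism $q$ with $jq=1$ for some inclusion $j$. A *cone* with vertex $z$ is a family of morphisms $\gamma(c)\colon c\to z$, $c\in v\mathcal C$, with $j(a,b)\gamma(b)=\gamma(a)$ whenever $a\preceq b$, at least one of which is an isomorphism. $\mathcal C$ is *normal* if every inclusion splits (has a right inverse), every morphism $f$ factors as $f=quj$ with $q$ a retraction, $u$ an isomorphism and $j$ an inclusion, and every object $c$ is the vertex of a cone $\mu$ with $\mu(c)=1_c$. Then $f^\circ:=qu$ depends only on $f$, and the set $\widehat{\mathcal C}$ of all cones is a regular semigroup under $(\gamma\cdot\delta)(c)=\gamma(c)\,(\delta(z_\gamma))^\circ$, where $z_\gamma$ is the vertex of $\gamma$. The set $\widehat{\mathcal C}/\mathscr R$ of $\mathscr R$-classes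 $R_\gamma$ is partially ordered by $R_\gamma\sqsubseteq R_\delta\iff\gamma\in\delta\,\widehat{\mathcal C}$. **Supported categories.** Let $\mathfrak D$ be a down-set of $\widehat{\mathcal C}/\mathscr R$. An object $c$ is *connected* by $\mathfrak d\in\mathfrak D$ if $\mathfrak d$ contains an idempotent cone with vertex $c$; this cone is unique and is denoted $\epsilon(c,\mathfrak d)$. The pair $\mathcal C_{\mathfrak D}$ is a *connected category* if every object is connected by some $\mathfrak d\in\mathfrak D$, and a *supported category* if every object is connected by exactly one $\mathfrak d\in\mathfrak D$. A morphism $\mathcal C_{\mathfrak D}\to\mathcal C'_{\mathfrak D'}$ is a pair $(F,G)$ of an inclusion preserving functor $F\colon\mathcal C\to\mathcal C'$ and an order preserving map $G\colon\mathfrak D\to\mathfrak D'$ such that, whenever $c$ is connected by $\mathfrak d$, $F(c)$ is connected by $G(\mathfrak d)$ and $F(\epsilon(c,\mathfrak d)(c'))=\epsilon(F(c),G(\mathfrak d))(F(c'))$ for all $c'\in v\mathcal C$. Let $\mathbf{SC}$ be the category of supported categories. For $\mathcal C_{\mathfrak D}$ in $\mathbf{SC}$ the idempotents $\epsilon(c,\mathfrak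 d)$ of the subsemigroup $\widehat{\mathcal C_{\mathfrak D}}=\{\gamma\in\widehat{\mathcal C}: R_\gamma\in\mathfrak D\}$ form a right regular band $\mathtt E(\mathcal C_{\mathfrak D})$, and $(F,G)\mapsto\big(\epsilon(c,\mathfrak d)\mapsto\epsilon(F(c),G(\mathfrak d))\big)$ makes $\mathtt E$ a functor to the category $\mathbf{RRB}$ of right regular bands. **Right regular bands.** A band (a semigroup of idempotents) is *right regular* if $efe=fe$, and *left regular* if $efe=ef$, for all elements $e,f$; let $\mathbf{RRB}$ and $\mathbf{LRB}$ be the categories of right and of left regular bands and semigroup homomorphisms. For a right regular band $S$ let $\mathbb L(S)$ be the category whose objects are the principal left ideals $Se$, whose morphisms $Se\to Sf$ are the maps $r(e,u,f)\colon x\mapsto xu$ with $u\in eSf$, and whose inclusions are the inclusion maps. For $a\in S$ let $r^a$ be the cone with vertex $Sa$ given by $r^a(Se)=r(e,ea,a)$, and let $\mathfrak R=\{R_{r^e}:e\in S\}$. Then $\mathtt C(S):=\mathbb L(S)_{\mathfrak R}$ is a supported category, and $\mathtt C$ becomes a functor $\mathbf{RRB}\to\mathbf{SC}$ by sending $\phi\colon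 S\to S'$ to $(F_\phi,G_\phi)$ with $F_\phi(Se)=S'(e\phi)$, $F_\phi(r(e,u,f))=r(e\phi,u\phi,f\phi)$ and $G_\phi(R_{r^e})=R_{r^{e\phi}}$. **Theorem.** The functor $\mathtt C\colon\mathbf{RRB}\to\mathbf{SC}$ is left adjoint to the functor $\mathtt E\colon\mathbf{SC}\to\mathbf{RRB}$, by an adjunction whose unit at $B$ is the homomorphism $B\to\mathtt E(\mathtt C(B))$, $b\mapsto r^b$. In particular, $\mathbf{RRB}$ is coreflective in $\mathbf{SC}$, that is, equivalent to a full subcategory of $\mathbf{SC}$ whose inclusion functor has a right adjoint. Dually, $\mathbf{LRB}$ is coreflective in $\mathbf{SC}$ in the same sense. -/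

import Mathlib

open CategoryTheory

universe u

namespace CrossConn

/-! ### Categories with subobjects and normal categories

Composition is written diagrammatically: `f ≫ g` is first `f`, then `g`. -/

/-- A small category together with a subcategory of inclusions, containing all objects, which is a
strict preorder of monomorphisms and which contains `h` whenever it contains `g` and `h ≫ g`. -/
class SubobjectCategory (C : Type u) [SmallCategory C] where
  incl : MorphismProperty C
  incl_id : ∀ a : C, incl (𝟙 a)
  incl_comp : ∀ {a b c : C} (f : a ⟶ b) (g : b ⟶ c), incl f → incl g → incl (f ≫ g)
  incl_unique : ∀ {a b : C} (f g : a ⟶ b), incl f → incl g → f = g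
  incl_antisymm : ∀ {a b : C} (f : a ⟶ b) (g : b ⟶ a), incl f → incl g → a = b
  incl_mono : ∀ {a b : C} (f : a ⟶ b), incl f → Mono f
  incl_of_comp : ∀ {a b c : C} (h : a ⟶ b) (g : b ⟶ c), incl g → incl (h ≫ g) → incl h

/-- The inclusions of a category with subobjects. -/
abbrev IsIncl {C : Type u} [SmallCategory C] [SubobjectCategory C] {a b : C} (f : a ⟶ b) : Prop :=
  SubobjectCategory.incl f

/-- A retraction is a right inverse of an inclusion. -/
def IsRetr {C : Type u} [SmallCategory C] [SubobjectCategory C] {a b : C} (q : a ⟶ b) : Prop :=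
  ∃ j : b ⟶ a, IsIncl j ∧ j ≫ q = 𝟙 b

/-- `f = q ≫ v ≫ j` with `q` a retraction, `v` an isomorphism and `j` an inclusion. -/
structure NormalFactorisation {C : Type u} [SmallCategory C] [SubobjectCategory C] {a b : C}
    (f : a ⟶ b) where
  coim : C
  im : C
  q : a ⟶ coim
  v : coim ⟶ im
  j : im ⟶ b
  q_retr : IsRetr q
  v_iso : IsIso v
  j_incl : IsIncl j
  fac : f = q ≫ v ≫ j

/-- A cone with vertex `z`. -/
@[ext]
structure Cone (C : Type u) [SmallCategory C] [SubobjectCategory C] (z : C) where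
  app : ∀ c : C, c ⟶ z
  w : ∀ {a b : C} (j : a ⟶ b), IsIncl j → j ≫ app b = app a
  exists_iso : ∃ c : C, IsIso (app c)

/-- The elements of `Hat C` are the cones of `C`, each paired with its vertex. -/
structure Hat (C : Type u) [SmallCategory C] [SubobjectCategory C] : Type u where
  vertex : C
  cone : Cone C vertex

/-- A normal category. -/
class NormalCategory (C : Type u) [SmallCategory C] [SubobjectCategory C] : Prop where
  splits : ∀ {a b : C} (j : a ⟶ b), IsIncl j → ∃ q : b ⟶ a, j ≫ q = 𝟙 a
  factors : ∀ {a b : C} (f : a ⟶ b), Nonempty (NormalFactorisation f)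
  exists_cone : ∀ c : C, ∃ γ : Cone C c, γ.app c = 𝟙 c

section

variable {C : Type u} [SmallCategory C] [SubobjectCategory C]

lemma incl_self {a : C} (j : a ⟶ a) (hj : IsIncl j) : j = 𝟙 a :=
  SubobjectCategory.incl_unique _ _ hj (SubobjectCategory.incl_id a)

lemma NormalFactorisation.epi {a b : C} {f : a ⟶ b} (n : NormalFactorisation f) :
    Epi (n.q ≫ n.v) := by
  obtain ⟨c, d, q, v, j, ⟨i, -, hi⟩, hv, hj, hf⟩ := n
  have h1 : IsSplitEpi q := ⟨⟨i, hi⟩⟩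
  change Epi (q ≫ v)
  infer_instance

variable [NormalCategory C]

lemma incl_epi {a b : C} (j : a ⟶ b) (hj : IsIncl j) [Epi j] : a = b := by
  obtain ⟨r, hr⟩ := NormalCategory.splits j hj
  have h : r ≫ j = 𝟙 b := by
    rw [← cancel_epi j, ← Category.assoc, hr, Category.id_comp, Category.comp_id]
  exact SubobjectCategory.incl_antisymm j r hj
    (SubobjectCategory.incl_of_comp r j hj (by rw [h]; exact SubobjectCategory.incl_id b))

lemma NormalFactorisation.unique {a b y : C} {f : a ⟶ b} (n : NormalFactorisation f)
    (p : a ⟶ y) [Epi p] (j : y ⟶ b) (hj : IsIncl j) (h : f = p ≫ j) :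
    (⟨y, p⟩ : Σ x : C, a ⟶ x) = ⟨n.im, n.q ≫ n.v⟩ := by
  obtain ⟨c, d, q, v, i, ⟨s, -, hs⟩, hv, hi, hf⟩ := n
  have hq : IsSplitEpi q := ⟨⟨s, hs⟩⟩
  have hqv : Epi (q ≫ v) := inferInstance
  change _ = (⟨d, q ≫ v⟩ : Σ x : C, a ⟶ x)
  have h2 : v ≫ i = s ≫ p ≫ j := by
    rw [← h, hf, ← Category.assoc s, hs, Category.id_comp]
  have hk : (inv v ≫ s ≫ p) ≫ j = i := by
    rw [Category.assoc, Category.assoc, ← h2, IsIso.inv_hom_id_assoc]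
  have hki : IsIncl (inv v ≫ s ≫ p) :=
    SubobjectCategory.incl_of_comp _ j hj (by rw [hk]; exact hi)
  generalize inv v ≫ s ≫ p = k at *
  have hpk : (q ≫ v) ≫ k = p := by
    have := SubobjectCategory.incl_mono j hj
    rw [← cancel_mono j, Category.assoc, hk, Category.assoc, ← hf, h]
  have hke : Epi k := by
    have : Epi ((q ≫ v) ≫ k) := by rw [hpk]; infer_instance
    exact epi_of_epi (q ≫ v) k
  obtain rfl := incl_epi k hki
  rw [incl_self k hki, Category.comp_id] at hpk
  rw [hpk]

/-- The factorisation of a morphism as an epimorphism followed by an inclusion is unique. -/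
lemma canonical_unique {a b x y : C} (p : a ⟶ x) [Epi p] (j : x ⟶ b) (hj : IsIncl j)
    (q : a ⟶ y) [Epi q] (k : y ⟶ b) (hk : IsIncl k) (h : p ≫ j = q ≫ k) :
    (⟨x, p⟩ : Σ x : C, a ⟶ x) = ⟨y, q⟩ := by
  obtain ⟨n⟩ := NormalCategory.factors (p ≫ j)
  rw [n.unique p j hj rfl, n.unique q k hk h]

/-- A chosen normal factorisation; the image and the epimorphic component that it gives do not
depend on the choice, see `NormalFactorisation.unique`. -/
noncomputable def normalFac {a b : C} (f : a ⟶ b) : NormalFactorisation f :=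
  Classical.choice (NormalCategory.factors f)

/-- The image of a morphism. -/
noncomputable def imObj {a b : C} (f : a ⟶ b) : C := (normalFac f).im

/-- The epimorphic component of a morphism. -/
noncomputable def epiPart {a b : C} (f : a ⟶ b) : a ⟶ imObj f :=
  (normalFac f).q ≫ (normalFac f).v

instance epiPart_epi {a b : C} (f : a ⟶ b) : Epi (epiPart f) := (normalFac f).epi

lemma canonical_exists {a b : C} (f : a ⟶ b) :
    ∃ (x : C) (p : a ⟶ x) (j : x ⟶ b), Epi p ∧ IsIncl j ∧ f = p ≫ j :=
  ⟨(normalFac f).im, (normalFac f).q ≫ (normalFac f).v, (normalFac f).j, (normalFac f).epi,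
    (normalFac f).j_incl, by rw [Category.assoc]; exact (normalFac f).fac⟩

lemma epi_split {a b : C} (p : a ⟶ b) [Epi p] : ∃ s : b ⟶ a, s ≫ p = 𝟙 b := by
  obtain ⟨c, d, q, v, j, ⟨i, -, hi⟩, hv, hj, hf⟩ := Classical.choice (NormalCategory.factors p)
  have : Epi j := by
    have : Epi ((q ≫ v) ≫ j) := by rw [Category.assoc, ← hf]; infer_instance
    exact epi_of_epi (q ≫ v) j
  obtain rfl := incl_epi j hj
  obtain rfl := incl_self j hj
  refine ⟨inv v ≫ i, ?_⟩
  rw [hf, Category.comp_id, Category.assoc, ← Category.assoc i, hi, Category.id_comp,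
    IsIso.inv_hom_id]

/-- The cone `c ↦ γ c ≫ p` for an epimorphism `p` starting at the vertex of `γ`. -/
def Cone.star {z x : C} (γ : Cone C z) (p : z ⟶ x) [Epi p] : Cone C x where
  app c := γ.app c ≫ p
  w j hj := by rw [← Category.assoc, γ.w j hj]
  exists_iso := by
    obtain ⟨d, hd⟩ := γ.exists_iso
    obtain ⟨c, y, q, v, j, ⟨i, hi, hiq⟩, hv, hj, hf⟩ :=
      Classical.choice (NormalCategory.factors (γ.app d ≫ p))
    have : Epi j := by
      have : Epi ((q ≫ v) ≫ j) := by rw [Category.assoc, ← hf]; infer_instance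
      exact epi_of_epi (q ≫ v) j
    obtain rfl := incl_epi j hj
    obtain rfl := incl_self j hj
    refine ⟨c, ?_⟩
    have h : γ.app c ≫ p = v := by
      rw [← γ.w i hi, Category.assoc, hf, ← Category.assoc, hiq, Category.id_comp,
        Category.comp_id]
    rw [h]
    exact hv

/-- The product of cones: `γ · δ = γ * (δ z)°`, where `z` is the vertex of `γ` and `°` denotes the
epimorphic component. -/
noncomputable instance : Mul (Hat C) where
  mul γ δ := ⟨imObj (δ.cone.app γ.vertex), γ.cone.star (epiPart (δ.cone.app γ.vertex))⟩

lemma star_congr {z x y : C} (γ : Cone C z) (p : z ⟶ x) [Epi p] (q : z ⟶ y) [Epi q]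
    (h : (⟨x, p⟩ : Σ x : C, z ⟶ x) = ⟨y, q⟩) : (⟨x, γ.star p⟩ : Hat C) = ⟨y, γ.star q⟩ := by
  obtain ⟨rfl, h2⟩ := Sigma.mk.inj_iff.1 h
  obtain rfl := eq_of_heq h2
  rfl

lemma hat_mul_eq {z x v : C} (γ : Cone C z) (δ : Cone C x) (p : z ⟶ v) [Epi p] (j : v ⟶ x)
    (hj : IsIncl j) (h : δ.app z = p ≫ j) :
    (⟨z, γ⟩ * ⟨x, δ⟩ : Hat C) = ⟨v, γ.star p⟩ :=
  (star_congr γ p (epiPart (δ.app z)) ((normalFac (δ.app z)).unique p j hj h)).symm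

/-- Every product of cones can be computed from some canonical factorisation. -/
lemma hat_mul_exists {z x : C} (γ : Cone C z) (δ : Cone C x) :
    ∃ (v : C) (p : z ⟶ v) (j : v ⟶ x) (_ : Epi p), IsIncl j ∧ δ.app z = p ≫ j ∧
      (⟨z, γ⟩ * ⟨x, δ⟩ : Hat C) = ⟨v, γ.star p⟩ := by
  obtain ⟨v, p, j, hp, hj, h⟩ := canonical_exists (δ.app z)
  exact ⟨v, p, j, hp, hj, h, hat_mul_eq γ δ p j hj h⟩

/-- The cones of a normal category form a semigroup. -/
noncomputable instance : Semigroup (Hat C) where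
  mul_assoc := by
    rintro ⟨z, γ⟩ ⟨x, δ⟩ ⟨y, σ⟩
    obtain ⟨v, p, j, hp, hj, h, e⟩ := hat_mul_exists γ δ
    obtain ⟨v₂, p₂, j₂, hp₂, hj₂, h₂, e₂⟩ := hat_mul_exists δ σ
    obtain ⟨t, q, k, hq, hk, hqk⟩ := canonical_exists (j ≫ p₂)
    have hpq : Epi (p ≫ q) := inferInstance
    rw [e, e₂, hat_mul_eq (γ.star p) σ q (k ≫ j₂) (SubobjectCategory.incl_comp _ _ hk hj₂)
        (by rw [← Category.assoc, ← hqk, Category.assoc, ← h₂, σ.w j hj]),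
      hat_mul_eq γ (δ.star p₂) (p ≫ q) k hk
        (by change δ.app z ≫ p₂ = _; rw [h, Category.assoc, hqk, Category.assoc])]
    refine congrArg (Hat.mk t) (Cone.ext (funext fun c => ?_))
    exact Category.assoc _ _ _

lemma mul_of_app_eq_id {z : C} (γ ε : Cone C z) (h : ε.app z = 𝟙 z) :
    (⟨z, γ⟩ * ⟨z, ε⟩ : Hat C) = ⟨z, γ⟩ := by
  rw [hat_mul_eq γ ε (𝟙 z) (𝟙 z) (SubobjectCategory.incl_id z) (by rw [h, Category.comp_id])]
  exact congrArg (Hat.mk z) (Cone.ext (funext fun c => Category.comp_id _))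

/-- The quasi-order `γ ≤ᵣ δ ↔ γ ∈ δ · Hat C`. -/
instance : Preorder (Hat C) where
  le γ δ := ∃ x : Hat C, γ = δ * x
  le_refl := by
    rintro ⟨z, γ⟩
    obtain ⟨μ, hμ⟩ := NormalCategory.exists_cone z
    exact ⟨⟨z, μ⟩, (mul_of_app_eq_id γ μ hμ).symm⟩
  le_trans := by
    rintro a b c ⟨x, rfl⟩ ⟨y, rfl⟩
    exact ⟨y * x, mul_assoc _ _ _⟩

lemma idem_le_iff {γ δ : Hat C} (hδ : IsIdempotentElem δ) : γ ≤ δ ↔ δ * γ = γ := by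
  constructor
  · rintro ⟨x, rfl⟩
    rw [← mul_assoc, hδ.eq]
  · intro h
    exact ⟨γ, h.symm⟩

lemma idem_app {z : C} (ε : Cone C z) : IsIdempotentElem (⟨z, ε⟩ : Hat C) ↔ ε.app z = 𝟙 z := by
  constructor
  · intro h
    obtain ⟨v, p, j, hp, hj, h1, e⟩ := hat_mul_exists ε ε
    replace h := e.symm.trans h
    obtain ⟨rfl, h2⟩ := Hat.mk.inj h
    obtain rfl := incl_self j hj
    rw [Category.comp_id] at h1
    subst h1
    obtain ⟨d, hd⟩ := ε.exists_iso
    have h3 := congrFun (congrArg Cone.app (eq_of_heq h2)) d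
    change ε.app d ≫ ε.app v = ε.app d at h3
    rw [← cancel_epi (ε.app d), h3, Category.comp_id]
  · exact mul_of_app_eq_id ε ε

end

/-- The poset of `ℛ`-classes of the semigroup of cones. -/
abbrev RPoset (C : Type u) [SmallCategory C] [SubobjectCategory C] [NormalCategory C] : Type u :=
  Antisymmetrization (Hat C) (· ≤ ·)

/-- The `ℛ`-class of a cone. -/
abbrev rClass {C : Type u} [SmallCategory C] [SubobjectCategory C] [NormalCategory C]
    (γ : Hat C) : RPoset C :=
  toAntisymmetrization (· ≤ ·) γ

/-- `ε` is the idempotent cone `ε(c, d)` with vertex `c` in the `ℛ`-class `d`. -/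
def IsIdemCone {C : Type u} [SmallCategory C] [SubobjectCategory C] [NormalCategory C]
    {c : C} (d : RPoset C) (ε : Cone C c) : Prop :=
  IsIdempotentElem (⟨c, ε⟩ : Hat C) ∧ rClass ⟨c, ε⟩ = d

/-- The object `c` is connected by the `ℛ`-class `d`. -/
def ConnectedBy {C : Type u} [SmallCategory C] [SubobjectCategory C] [NormalCategory C]
    (c : C) (d : RPoset C) : Prop :=
  ∃ ε : Cone C c, IsIdemCone d ε

/-- There is at most one idempotent cone with a given vertex in a given `ℛ`-class. -/
lemma IsIdemCone.unique {C : Type u} [SmallCategory C] [SubobjectCategory C] [NormalCategory C]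
    {c : C} {d : RPoset C} {ε ε' : Cone C c} (h : IsIdemCone d ε) (h' : IsIdemCone d ε') :
    ε = ε' := by
  obtain ⟨hi, hd⟩ := h
  obtain ⟨hi', rfl⟩ := h'
  have hle : (⟨c, ε⟩ : Hat C) ≤ ⟨c, ε'⟩ := (Quotient.exact hd).1
  rw [idem_le_iff hi', mul_of_app_eq_id _ _ ((idem_app ε).1 hi)] at hle
  exact (eq_of_heq (Hat.mk.inj hle).2).symm


/-! ### Connected and supported categories -/

/-- A connected category: a normal category with a down-set `D` of the poset of `ℛ`-classes of its
semigroup of cones such that every object is connected by some member of `D`. -/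
structure CC : Type (u + 1) where
  carrier : Type u
  [cat : SmallCategory carrier]
  [sub : SubobjectCategory carrier]
  [normal : NormalCategory carrier]
  D : LowerSet (RPoset carrier)
  connected : ∀ c : carrier, ∃ d ∈ D, ConnectedBy c d

attribute [instance] CC.cat CC.sub CC.normal

/-- A CC-morphism `(F, G)`. The last two fields say that `F c` is connected by `G d` whenever `c` is
connected by `d`, and that then `F (ε(c, d) c') = ε(F c, G d) (F c')` for all objects `c'`. -/
@[ext]
structure CC.Hom (X Y : CC.{u}) where
  F : X.carrier ⥤ Y.carrier
  G : X.D →o Y.D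
  map_incl : ∀ {a b : X.carrier} (j : a ⟶ b), IsIncl j → IsIncl (F.map j)
  map_connected : ∀ (c : X.carrier) (d : X.D), ConnectedBy c d.1 → ConnectedBy (F.obj c) (G d).1
  map_cone : ∀ (c : X.carrier) (d : X.D) (ε : Cone X.carrier c) (ε' : Cone Y.carrier (F.obj c)),
    IsIdemCone d.1 ε → IsIdemCone (G d).1 ε' →
      ∀ c' : X.carrier, F.map (ε.app c') = ε'.app (F.obj c')

/-- The category of connected categories and CC-morphisms. -/
instance : Category CC.{u} where
  Hom := CC.Hom
  id X :=
    { F := 𝟭 X.carrier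
      G := OrderHom.id
      map_incl := fun _ hj => hj
      map_connected := fun _ _ h => h
      map_cone := fun _ _ _ _ h h' _ => by obtain rfl := h.unique h'; rfl }
  comp {X Y Z} m n :=
    { F := m.F ⋙ n.F
      G := n.G.comp m.G
      map_incl := fun j hj => n.map_incl _ (m.map_incl j hj)
      map_connected := fun c d h => n.map_connected _ _ (m.map_connected c d h)
      map_cone := fun c d ε ε'' h h'' c' => by
        obtain ⟨ε', h'⟩ := m.map_connected c d ⟨ε, h⟩
        exact (congrArg n.F.map (m.map_cone c d ε ε' h h' c')).trans
          (n.map_cone _ _ ε' ε'' h' h'' _) }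

/-- The connection semigroup of a connected category. -/
noncomputable def CC.connectionSemigroup (X : CC.{u}) : Subsemigroup (Hat X.carrier) where
  carrier := {γ | rClass γ ∈ X.D}
  mul_mem' := fun {γ δ} hγ _ =>
    X.D.lower (toAntisymmetrization_le_toAntisymmetrization_iff.2 ⟨δ, rfl⟩ :
      rClass (γ * δ) ≤ rClass γ) hγ

/-- A connected category is supported if every object is connected by a unique member of `D`. -/
def CC.IsSupported (X : CC.{u}) : Prop :=
  ∀ c : X.carrier, ∃! d : RPoset X.carrier, d ∈ X.D ∧ ConnectedBy c d

/-- The category of supported categories, a full subcategory of `CC`. -/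
abbrev SC : Type (u + 1) := ObjectProperty.FullSubcategory CC.IsSupported.{u}

/-! ### Right and left regular bands -/

/-- A right regular band. -/
class IsRightRegularBand (S : Type u) [Semigroup S] : Prop where
  idem : ∀ e : S, e * e = e
  reg : ∀ e f : S, e * f * e = f * e

/-- A left regular band. -/
class IsLeftRegularBand (S : Type u) [Semigroup S] : Prop where
  idem : ∀ e : S, e * e = e
  reg : ∀ e f : S, e * f * e = e * f

/-- The category of right regular bands, a full subcategory of the category of semigroups. -/
abbrev RRB : Type (u + 1) :=
  ObjectProperty.FullSubcategory fun S : Semigrp.{u} => IsRightRegularBand S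

/-- The category of left regular bands, a full subcategory of the category of semigroups. -/
abbrev LRB : Type (u + 1) :=
  ObjectProperty.FullSubcategory fun S : Semigrp.{u} => IsLeftRegularBand S

/-! ### The band of idempotent cones of a supported category -/

section

variable {C : Type u} [SmallCategory C] [SubobjectCategory C] [NormalCategory C]

lemma hat_regular (γ : Hat C) : ∃ χ : Hat C, γ * χ * γ = γ := by
  obtain ⟨z, γ⟩ := γ
  obtain ⟨d, hd⟩ := γ.exists_iso
  obtain ⟨μ, hμ⟩ := NormalCategory.exists_cone z
  refine ⟨⟨d, μ.star (inv (γ.app d))⟩, ?_⟩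
  rw [hat_mul_eq γ (μ.star (inv (γ.app d))) (inv (γ.app d)) (𝟙 d) (SubobjectCategory.incl_id d)
      (by change μ.app z ≫ _ = _; rw [hμ, Category.id_comp, Category.comp_id]),
    hat_mul_eq (γ.star (inv (γ.app d))) γ (γ.app d) (𝟙 z) (SubobjectCategory.incl_id z)
      (Category.comp_id _).symm]
  refine congrArg (Hat.mk z) (Cone.ext (funext fun c => ?_))
  change (γ.app c ≫ inv (γ.app d)) ≫ γ.app d = γ.app c
  rw [Category.assoc, IsIso.inv_hom_id, Category.comp_id]

/-- `ℒ`-related cones have the same vertex. -/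
lemma vertex_eq_of_mul {e f : Hat C} (h1 : e * f = e) (h2 : f * e = f) : e.vertex = f.vertex := by
  obtain ⟨z, γ⟩ := e
  obtain ⟨x, δ⟩ := f
  obtain ⟨v, p, j, _, hj, -, e1⟩ := hat_mul_exists γ δ
  obtain ⟨v', p', j', _, hj', -, e2⟩ := hat_mul_exists δ γ
  obtain ⟨rfl, -⟩ := Hat.mk.inj (e1.symm.trans h1)
  obtain ⟨rfl, -⟩ := Hat.mk.inj (e2.symm.trans h2)
  exact SubobjectCategory.incl_antisymm j j' hj hj'

end

section

variable {X : CC.{u}}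

/-- In a supported category there is a unique idempotent cone with a given vertex. -/
lemma idem_eq_of_vertex (hX : X.IsSupported) {e f : Hat X.carrier} (he : IsIdempotentElem e)
    (hf : IsIdempotentElem f) (he' : e ∈ X.connectionSemigroup) (hf' : f ∈ X.connectionSemigroup)
    (h : e.vertex = f.vertex) : e = f := by
  obtain ⟨z, γ⟩ := e
  obtain ⟨x, δ⟩ := f
  obtain rfl : z = x := h
  have hd := (hX z).unique ⟨he', γ, he, rfl⟩ ⟨hf', δ, hf, rfl⟩
  exact congrArg (Hat.mk z) (IsIdemCone.unique ⟨he, hd⟩ ⟨hf, rfl⟩)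

lemma idem_eq_of_mul (hX : X.IsSupported) {e f : Hat X.carrier} (he : IsIdempotentElem e)
    (hf : IsIdempotentElem f) (he' : e ∈ X.connectionSemigroup) (hf' : f ∈ X.connectionSemigroup)
    (h1 : e * f = e) (h2 : f * e = f) : e = f :=
  idem_eq_of_vertex hX he hf he' hf' (vertex_eq_of_mul h1 h2)

lemma mul_mem_connection {e : Hat X.carrier} (he : e ∈ X.connectionSemigroup) (x : Hat X.carrier) :
    e * x ∈ X.connectionSemigroup :=
  X.D.lower (toAntisymmetrization_le_toAntisymmetrization_iff.2 ⟨x, rfl⟩ :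
      rClass (e * x) ≤ rClass e) he

lemma idem_mul (hX : X.IsSupported) {e f : Hat X.carrier} (he : IsIdempotentElem e)
    (hf : IsIdempotentElem f) (he' : e ∈ X.connectionSemigroup) (hf' : f ∈ X.connectionSemigroup) :
    IsIdempotentElem (e * f) := by
  obtain ⟨y, hy⟩ := hat_regular (e * f)
  have hee : ∀ a, e * (e * a) = e * a := fun a => by rw [← mul_assoc, he.eq]
  have hff : ∀ a, f * (f * a) = f * a := fun a => by rw [← mul_assoc, hf.eq]
  obtain ⟨x, hx1, hx2⟩ : ∃ x, e * f * x * (e * f) = e * f ∧ x * (e * f) * x = x := by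
    refine ⟨y * (e * f) * y, ?_, ?_⟩
    · calc e * f * (y * (e * f) * y) * (e * f) = (e * f * y * (e * f)) * y * (e * f) := by
            simp only [mul_assoc]
        _ = e * f := by rw [hy, hy]
    · calc y * (e * f) * y * (e * f) * (y * (e * f) * y)
          = y * ((e * f * y * (e * f)) * y * (e * f)) * y := by simp only [mul_assoc]
        _ = y * (e * f) * y := by rw [hy, hy]
  obtain ⟨g, hg⟩ : ∃ g, g = f * x * e := ⟨_, rfl⟩
  have hgi : g * g = g := by
    calc g * g = f * (x * (e * f) * x) * e := by rw [hg]; simp only [mul_assoc]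
      _ = g := by rw [hx2, hg]
  have hge : g * e = g := by rw [hg, mul_assoc, he.eq]
  have hfg : f * g = g := by rw [hg, ← mul_assoc, ← mul_assoc, hf.eq]
  have haga : e * f * g * (e * f) = e * f := by
    calc e * f * g * (e * f) = e * (f * (f * (x * (e * (e * f))))) := by
          rw [hg]; simp only [mul_assoc]
      _ = e * f * x * (e * f) := by rw [hff, hee]; simp only [mul_assoc]
      _ = e * f := hx1
  have hgm : g ∈ X.connectionSemigroup := by
    rw [hg, mul_assoc]; exact mul_mem_connection hf' _
  have hegi : IsIdempotentElem (e * g) := by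
    change e * g * (e * g) = e * g
    calc e * g * (e * g) = e * (g * e * g) := by simp only [mul_assoc]
      _ = e * g := by rw [hge, hgi]
  have heg : e * g = g := by
    refine idem_eq_of_mul hX hegi hgi (mul_mem_connection he' _) hgm ?_ ?_
    · rw [mul_assoc, hgi]
    · rw [← mul_assoc, hge, hgi]
  have hef : e * f = g * f := by
    calc e * f = e * f * g * (e * f) := haga.symm
      _ = e * (f * g) * (e * f) := by simp only [mul_assoc]
      _ = g * e * f := by rw [hfg, heg, mul_assoc]
      _ = g * f := by rw [hge]
  change e * f * (e * f) = e * f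
  rw [hef]
  calc g * f * (g * f) = g * (f * g) * f := by simp only [mul_assoc]
    _ = g * f := by rw [hfg, hgi]

lemma idem_reg (hX : X.IsSupported) {e f : Hat X.carrier} (he : IsIdempotentElem e)
    (hf : IsIdempotentElem f) (he' : e ∈ X.connectionSemigroup) (hf' : f ∈ X.connectionSemigroup) :
    e * f * e = f * e := by
  have h1 := idem_mul hX he hf he' hf'
  have h2 := idem_mul hX hf he hf' he'
  have h3 := idem_mul hX h1 he (mul_mem_connection he' f) he'
  refine idem_eq_of_mul hX h3 h2 (mul_mem_connection (mul_mem_connection he' f) e)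
    (mul_mem_connection hf' e) ?_ ?_
  · calc e * f * e * (f * e) = e * (f * e * (f * e)) := by simp only [mul_assoc]
      _ = e * f * e := by rw [h2.eq, mul_assoc]
  · calc f * e * (e * f * e) = f * (e * e) * (f * e) := by simp only [mul_assoc]
      _ = f * e := by rw [he.eq, h2.eq]

end

/-- The idempotent cones in the connection semigroup of a supported category. -/
def IdemCones (X : SC.{u}) : Type u := {γ : X.obj.connectionSemigroup // IsIdempotentElem γ}

lemma IdemCones.idem {X : SC.{u}} (γ : IdemCones X) : IsIdempotentElem γ.1.1 :=
  congrArg Subtype.val γ.2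

lemma IdemCones.ext {X : SC.{u}} {γ δ : IdemCones X} (h : γ.1.1.vertex = δ.1.1.vertex) : γ = δ :=
  Subtype.ext (Subtype.ext (idem_eq_of_vertex X.property γ.idem δ.idem γ.1.2 δ.1.2 h))

noncomputable instance (X : SC.{u}) : Semigroup (IdemCones X) where
  mul γ δ := ⟨γ.1 * δ.1, Subtype.ext (idem_mul X.property γ.idem δ.idem γ.1.2 δ.1.2)⟩
  mul_assoc _ _ _ := Subtype.ext (mul_assoc _ _ _)

instance (X : SC.{u}) : IsRightRegularBand (IdemCones X) where
  idem γ := Subtype.ext γ.2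
  reg γ δ := Subtype.ext (Subtype.ext (idem_reg X.property γ.idem δ.idem γ.1.2 δ.1.2))

/-- The CC-morphism underlying an SC-morphism. -/
def scHom {X Y : SC.{u}} (m : X ⟶ Y) : CC.Hom X.obj Y.obj := m.hom

/-- For an SC-morphism `(F, G)`, the map `ε(c, d) ↦ ε(F c, G d)`. -/
noncomputable def idemMap {X Y : SC.{u}} (m : X ⟶ Y) (γ : IdemCones X) : IdemCones Y :=
  have h := (scHom m).map_connected γ.1.1.vertex ⟨rClass γ.1.1, γ.1.2⟩ ⟨γ.1.1.cone, γ.idem, rfl⟩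
  ⟨⟨⟨(scHom m).F.obj γ.1.1.vertex, h.choose⟩, by
      change rClass _ ∈ Y.obj.D
      rw [h.choose_spec.2]
      exact ((scHom m).G ⟨rClass γ.1.1, γ.1.2⟩).2⟩,
    Subtype.ext h.choose_spec.1⟩

lemma idemMap_vertex {X Y : SC.{u}} (m : X ⟶ Y) (γ : IdemCones X) :
    (idemMap m γ).1.1.vertex = (scHom m).F.obj γ.1.1.vertex := rfl

lemma idemMap_isIdemCone {X Y : SC.{u}} (m : X ⟶ Y) (γ : IdemCones X) :
    IsIdemCone ((scHom m).G ⟨rClass γ.1.1, γ.1.2⟩).1 (idemMap m γ).1.1.cone :=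
  ((scHom m).map_connected γ.1.1.vertex ⟨rClass γ.1.1, γ.1.2⟩
    ⟨γ.1.1.cone, γ.idem, rfl⟩).choose_spec

lemma idemMap_app {X Y : SC.{u}} (m : X ⟶ Y) (γ : IdemCones X) (c : X.obj.carrier) :
    (scHom m).F.map (γ.1.1.cone.app c) = (idemMap m γ).1.1.cone.app ((scHom m).F.obj c) :=
  (scHom m).map_cone _ ⟨rClass γ.1.1, γ.1.2⟩ γ.1.1.cone (idemMap m γ).1.1.cone ⟨γ.idem, rfl⟩
    (idemMap_isIdemCone m γ) c

lemma map_mul_vertex {X Y : CC.{u}} (m : CC.Hom X Y) {z x : X.carrier} (γ : Cone X.carrier z)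
    (δ : Cone X.carrier x) (γ' : Cone Y.carrier (m.F.obj z)) (δ' : Cone Y.carrier (m.F.obj x))
    (hδ : ∀ c, m.F.map (δ.app c) = δ'.app (m.F.obj c)) :
    m.F.obj (⟨z, γ⟩ * ⟨x, δ⟩ : Hat X.carrier).vertex =
      (⟨m.F.obj z, γ'⟩ * ⟨m.F.obj x, δ'⟩ : Hat Y.carrier).vertex := by
  obtain ⟨v, p, j, hp, hj, h, e⟩ := hat_mul_exists γ δ
  have hFp : Epi (m.F.map p) := by
    obtain ⟨s, hs⟩ := epi_split p
    have : IsSplitEpi (m.F.map p) := ⟨⟨m.F.map s, by rw [← m.F.map_comp, hs, m.F.map_id]⟩⟩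
    infer_instance
  rw [e, hat_mul_eq γ' δ' (m.F.map p) (m.F.map j) (m.map_incl j hj)
    (by rw [← hδ, h, m.F.map_comp])]

lemma idemMap_mul {X Y : SC.{u}} (m : X ⟶ Y) (γ δ : IdemCones X) :
    idemMap m (γ * δ) = idemMap m γ * idemMap m δ :=
  IdemCones.ext (map_mul_vertex (scHom m) γ.1.1.cone δ.1.1.cone (idemMap m γ).1.1.cone
    (idemMap m δ).1.1.cone (idemMap_app m δ))

/-- The functor from supported categories to right regular bands, taking a supported category to
the band of its idempotent cones. -/
noncomputable def idemFunctor : SC.{u} ⥤ RRB.{u} where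
  obj X := ⟨Semigrp.of (IdemCones X), inferInstanceAs (IsRightRegularBand (IdemCones X))⟩
  map m := ObjectProperty.homMk (Semigrp.ofHom ⟨idemMap m, idemMap_mul m⟩)
  map_id X := by
    refine ObjectProperty.hom_ext _ (Semigrp.ext fun γ => ?_)
    exact IdemCones.ext (X := X) rfl
  map_comp {X Y Z} m n := by
    refine ObjectProperty.hom_ext _ (Semigrp.ext fun γ => ?_)
    exact IdemCones.ext (X := Z) rfl

/-! ### The category of principal left ideals -/

/-- The principal left ideal `S e`. -/
def leftIdeal {S : Type u} [Semigroup S] (e : S) : Set S := {x | ∃ s : S, x = s * e}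

lemma mem_leftIdeal {S : Type u} [Semigroup S] {e x : S} (he : e * e = e) :
    x ∈ leftIdeal e ↔ x * e = x := by
  constructor
  · rintro ⟨s, rfl⟩
    rw [mul_assoc, he]
  · intro h
    exact ⟨x, h.symm⟩

/-- The objects of the category of principal left ideals: the left ideals `S e` with `e` an
idempotent. -/
@[ext]
structure LeftCat (S : Type u) [Semigroup S] : Type u where
  carrier : Set S
  principal : ∃ e : S, e * e = e ∧ carrier = leftIdeal e

/-- The morphisms `r(e, u, f)` with `u ∈ e S f`, that is the maps `S e → S f`, `x ↦ x u`. -/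
@[ext]
structure LeftCat.Hom {S : Type u} [Semigroup S] (I J : LeftCat S) : Type u where
  toFun : I.carrier → J.carrier
  spec : ∃ e f u : S, e * e = e ∧ f * f = f ∧ I.carrier = leftIdeal e ∧ J.carrier = leftIdeal f ∧
    (∃ s : S, u = e * s * f) ∧ ∀ x : I.carrier, (toFun x : S) = x * u

instance {S : Type u} [Semigroup S] : SmallCategory (LeftCat S) where
  Hom := LeftCat.Hom
  id I :=
    { toFun := id
      spec := by
        obtain ⟨e, he, hI⟩ := I.principal
        exact ⟨e, e, e, he, he, hI, hI, ⟨e, by rw [he, he]⟩,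
          fun x => ((mem_leftIdeal he).1 (hI.le x.2)).symm⟩ }
  comp m n :=
    { toFun := n.toFun ∘ m.toFun
      spec := by
        obtain ⟨e, f, u, he, hf, hI, hJ, ⟨s, hs⟩, hu⟩ := m.spec
        obtain ⟨g, h, v, hg, hh, hJ', hK, ⟨t, ht⟩, hv⟩ := n.spec
        refine ⟨e, h, u * v, he, hh, hI, hK, ⟨s * f * g * t, ?_⟩, fun x => ?_⟩
        · rw [hs, ht]; simp only [mul_assoc]
        · rw [Function.comp_apply, hv, hu, mul_assoc] }

section

variable {S : Type u} [Semigroup S]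

/-- The value of a morphism, as an element of the semigroup. -/
def LeftCat.val {I J : LeftCat S} (m : I ⟶ J) (x : I.carrier) : S := (LeftCat.Hom.toFun m x : S)

lemma LeftCat.hom_ext {I J : LeftCat S} {m n : I ⟶ J} (h : ∀ x, val m x = val n x) : m = n :=
  LeftCat.Hom.ext (funext fun x => Subtype.ext (h x))

lemma LeftCat.val_id {I : LeftCat S} (x : I.carrier) : val (𝟙 I) x = x := rfl

lemma LeftCat.val_comp {I J K : LeftCat S} (m : I ⟶ J) (n : J ⟶ K) (x : I.carrier) :
    val (m ≫ n) x = val n (LeftCat.Hom.toFun m x) := rfl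

/-- The inclusions are the inclusion maps between principal left ideals. -/
instance : SubobjectCategory (LeftCat S) where
  incl := fun _ _ m => ∀ x, LeftCat.val m x = x
  incl_id _ _ := rfl
  incl_comp f g hf hg x := (hg _).trans (hf x)
  incl_unique f g hf hg := LeftCat.hom_ext fun x => (hf x).trans (hg x).symm
  incl_antisymm {a b} f g hf hg := LeftCat.ext (Set.Subset.antisymm
    (fun x hx => Set.mem_of_eq_of_mem (hf ⟨x, hx⟩).symm (LeftCat.Hom.toFun f ⟨x, hx⟩).2)
    (fun x hx => Set.mem_of_eq_of_mem (hg ⟨x, hx⟩).symm (LeftCat.Hom.toFun g ⟨x, hx⟩).2))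
  incl_mono f hf := ⟨fun g h e => LeftCat.hom_ext fun x => by
    have h1 := congrArg (fun m => LeftCat.val m x) e
    exact ((hf _).symm.trans h1).trans (hf _)⟩
  incl_of_comp h g hg hhg x := (hg _).symm.trans (hhg x)

namespace LeftCat

/-- The object `S e`. -/
def of (e : S) (he : e * e = e) : LeftCat S := ⟨leftIdeal e, e, he, rfl⟩

/-- An idempotent generator. -/
noncomputable def gen (I : LeftCat S) : S := I.principal.choose

lemma gen_idem (I : LeftCat S) : gen I * gen I = gen I := I.principal.choose_spec.1

lemma carrier_eq (I : LeftCat S) : I.carrier = leftIdeal (gen I) := I.principal.choose_spec.2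

lemma of_gen (I : LeftCat S) : of (gen I) (gen_idem I) = I := LeftCat.ext (carrier_eq I).symm

lemma exists_of (I : LeftCat S) : ∃ (e : S) (he : e * e = e), I = of e he :=
  ⟨gen I, gen_idem I, (of_gen I).symm⟩

lemma gen_mem (I : LeftCat S) : gen I ∈ I.carrier := by
  rw [carrier_eq]; exact ⟨gen I, (gen_idem I).symm⟩

lemma mem_iff {I : LeftCat S} {x : S} : x ∈ I.carrier ↔ x * gen I = x := by
  rw [carrier_eq, mem_leftIdeal (gen_idem I)]

lemma mem_of {e x : S} (he : e * e = e) : x ∈ (of e he).carrier ↔ x * e = x := mem_leftIdeal he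

/-- The morphism `r(e, u, f)`, where `e u = u = u f`. -/
def homOf {e f : S} (he : e * e = e) (hf : f * f = f) (u : S) (h1 : e * u = u) (h2 : u * f = u) :
    of e he ⟶ of f hf :=
  LeftCat.Hom.mk (fun x => ⟨x * u, (mem_of hf).2 (by rw [mul_assoc, h2])⟩)
    ⟨e, f, u, he, hf, rfl, rfl, ⟨u, by rw [h1, h2]⟩, fun _ => rfl⟩

lemma val_homOf {e f : S} (he : e * e = e) (hf : f * f = f) (u : S) (h1 : e * u = u)
    (h2 : u * f = u) (x : (of e he).carrier) : val (homOf he hf u h1 h2) x = x * u := rfl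

lemma hom_form {e f : S} {he : e * e = e} {hf : f * f = f} (m : of e he ⟶ of f hf) :
    ∃ u : S, e * u = u ∧ u * f = u ∧ ∀ x, val m x = x * u := by
  obtain ⟨-, -, u, -, -, -, -, -, hu⟩ := LeftCat.Hom.spec m
  have hee : e ∈ (of e he).carrier := (mem_of he).2 he
  have h0 : val m ⟨e, hee⟩ = e * u := hu _
  refine ⟨e * u, by rw [← mul_assoc, he], ?_, fun x => ?_⟩
  · rw [← h0]; exact (mem_of hf).1 (LeftCat.Hom.toFun m ⟨e, hee⟩).2
  · rw [← mul_assoc, (mem_of he).1 x.2]; exact hu x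

/-- A morphism is determined by its value at a generator. -/
lemma val_eq_gen {I J : LeftCat S} (m : I ⟶ J) (x : I.carrier) :
    val m x = x * val m ⟨gen I, gen_mem I⟩ := by
  obtain ⟨-, -, u, -, -, -, -, -, hu⟩ := LeftCat.Hom.spec m
  have h1 : val m x = x * u := hu x
  have h2 : val m ⟨gen I, gen_mem I⟩ = gen I * u := hu _
  rw [h1, h2, ← mul_assoc, mem_iff.1 x.2]

lemma val_gen_mul {I J : LeftCat S} (m : I ⟶ J) :
    gen I * val m ⟨gen I, gen_mem I⟩ = val m ⟨gen I, gen_mem I⟩ :=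
  (val_eq_gen m ⟨gen I, gen_mem I⟩).symm

lemma val_mul_gen {I J : LeftCat S} (m : I ⟶ J) (x : I.carrier) : val m x * gen J = val m x :=
  mem_iff.1 (LeftCat.Hom.toFun m x).2

lemma val_eqToHom {I J : LeftCat S} (h : I = J) (x : I.carrier) : val (eqToHom h) x = x := by
  subst h; rfl

lemma surj_of_isIso {I J : LeftCat S} (m : I ⟶ J) [IsIso m] (y : J.carrier) :
    ∃ x, val m x = y := by
  refine ⟨LeftCat.Hom.toFun (inv m) y, ?_⟩
  rw [← val_comp, IsIso.inv_hom_id]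
  rfl

lemma epi_of_surj {I J : LeftCat S} (m : I ⟶ J) (h : ∀ y : J.carrier, ∃ x, val m x = y) :
    Epi m := by
  refine ⟨fun g k e => hom_ext fun y => ?_⟩
  obtain ⟨x, hx⟩ := h y
  obtain rfl : LeftCat.Hom.toFun m x = y := Subtype.ext hx
  exact congrArg (fun n => val n x) e

/-- The principal cone `r^a` of an idempotent `a`, with `r^a (S e) = r(e, e a, a)`. -/
def principalCone (a : S) (ha : a * a = a) : Cone (LeftCat S) (of a ha) where
  app I := LeftCat.Hom.mk (fun x => ⟨x * a, x, rfl⟩) (by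
    obtain ⟨e, he, hI⟩ := I.principal
    refine ⟨e, a, e * a, he, ha, hI, rfl, ⟨a, by rw [mul_assoc, ha]⟩, fun x => ?_⟩
    rw [← mul_assoc, (mem_leftIdeal he).1 (hI.le x.2)])
  w {I J} j hj := hom_ext fun x => congrArg (· * a) (hj x)
  exists_iso := by
    refine ⟨of a ha, 𝟙 (of a ha), ?_, ?_⟩ <;>
    exact hom_ext fun x => (mem_of ha).1 x.2

lemma val_principalCone (a : S) (ha : a * a = a) (I : LeftCat S) (x : I.carrier) :
    val ((principalCone a ha).app I) x = x * a := rfl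

lemma hat_ext {γ δ : Hat (LeftCat S)} (hv : γ.vertex.carrier = δ.vertex.carrier)
    (h : ∀ I x, val (γ.cone.app I) x = val (δ.cone.app I) x) : γ = δ := by
  obtain ⟨z, γ⟩ := γ
  obtain ⟨x, δ⟩ := δ
  obtain rfl : z = x := LeftCat.ext hv
  exact congrArg (Hat.mk z) (Cone.ext (funext fun I => hom_ext (h I)))

end LeftCat

end

section

variable {S : Type u} [Semigroup S] [IsRightRegularBand S]

open IsRightRegularBand

/-- The category of principal left ideals of a right regular band is normal. -/
instance : NormalCategory (LeftCat S) where
  splits {I J} j hj := by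
    obtain ⟨e, he, rfl⟩ := I.exists_of
    obtain ⟨f, hf, rfl⟩ := J.exists_of
    refine ⟨LeftCat.homOf hf he (f * e) (by rw [← mul_assoc, hf]) (by rw [mul_assoc, he]), ?_⟩
    refine LeftCat.hom_ext fun x => ?_
    have hx : (x : S) * f = x := by
      have h := (LeftCat.mem_of hf).1 (LeftCat.Hom.toFun j x).2
      rwa [show ((LeftCat.Hom.toFun j x : _) : S) = x from hj x] at h
    rw [LeftCat.val_comp, LeftCat.val_homOf, show ((LeftCat.Hom.toFun j x : _) : S) = x from hj x,
      ← mul_assoc, hx]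
    exact (LeftCat.mem_of he).1 x.2
  factors {I J} m := by
    obtain ⟨e, he, rfl⟩ := I.exists_of
    obtain ⟨f, hf, rfl⟩ := J.exists_of
    obtain ⟨a, h1, h2, hm⟩ := LeftCat.hom_form m
    have ha : a * a = a := idem a
    have hae : a * e * (a * e) = a * e := idem _
    have haea : a * e * a = a := by rw [mul_assoc, h1, ha]
    have hiso : IsIso (LeftCat.homOf hae ha a haea ha) := by
      refine ⟨LeftCat.homOf ha hae (a * e) (by rw [← mul_assoc, ha]) hae, ?_, ?_⟩
      · refine LeftCat.hom_ext fun x => ?_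
        change (x * a) * (a * e) = (x : S)
        rw [mul_assoc, ← mul_assoc a, ha]
        exact (LeftCat.mem_of hae).1 x.2
      · refine LeftCat.hom_ext fun x => ?_
        change (x * (a * e)) * a = (x : S)
        rw [mul_assoc, haea]
        exact (LeftCat.mem_of ha).1 x.2
    exact ⟨{
      coim := LeftCat.of (a * e) hae
      im := LeftCat.of a ha
      q := LeftCat.homOf he hae (a * e) (by rw [← mul_assoc, h1]) hae
      v := LeftCat.homOf hae ha a haea ha
      j := LeftCat.homOf ha hf a ha h2
      q_retr := by
        refine ⟨LeftCat.homOf hae he (a * e) hae (by rw [mul_assoc, he]), fun x => ?_, ?_⟩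
        · exact (LeftCat.mem_of hae).1 x.2
        · refine LeftCat.hom_ext fun x => ?_
          change (x * (a * e)) * (a * e) = (x : S)
          rw [mul_assoc, hae]
          exact (LeftCat.mem_of hae).1 x.2
      v_iso := hiso
      j_incl := fun x => (LeftCat.mem_of ha).1 x.2
      fac := by
        refine LeftCat.hom_ext fun x => ?_
        rw [hm]
        change x * a = x * (a * e) * a * a
        rw [mul_assoc (x : S), haea, mul_assoc, ha] }⟩
  exists_cone I := by
    obtain ⟨e, he, rfl⟩ := I.exists_of
    exact ⟨LeftCat.principalCone e he, LeftCat.hom_ext fun x => (LeftCat.mem_of he).1 x.2⟩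

/-- The principal cone `r^a` as an element of the semigroup of cones. -/
def principal (a : S) : Hat (LeftCat S) := ⟨LeftCat.of a (idem a), LeftCat.principalCone a (idem a)⟩

lemma of_injective {a b : S} (ha : a * a = a) (hb : b * b = b)
    (h : LeftCat.of a ha = LeftCat.of b hb) : a = b := by
  have h1 : a * b = a := (LeftCat.mem_of hb).1 (h ▸ (LeftCat.mem_of ha).2 ha)
  have h2 : b * a = b := (LeftCat.mem_of ha).1 (h.symm ▸ (LeftCat.mem_of hb).2 hb)
  calc a = a * b := h1.symm
    _ = b * a * b := (reg b a).symm
    _ = b := by rw [h2, hb]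

lemma gen_of (a : S) (ha : a * a = a) : LeftCat.gen (LeftCat.of a ha) = a :=
  of_injective (LeftCat.gen_idem _) ha (LeftCat.of_gen _)

lemma principal_injective {a b : S} (h : principal a = principal b) : a = b :=
  of_injective (idem a) (idem b) (congrArg Hat.vertex h)

lemma principal_mul (a b : S) : principal a * principal b = principal (a * b) := by
  have ha : a * a = a := idem a
  have hb : b * b = b := idem b
  have hab : a * b * (a * b) = a * b := idem _
  have h1 : a * (a * b) = a * b := by rw [← mul_assoc, ha]
  have h2 : a * b * b = a * b := by rw [mul_assoc, hb]
  have hepi : Epi (LeftCat.homOf ha hab (a * b) h1 hab) := by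
    refine LeftCat.epi_of_surj _ fun y => ?_
    obtain ⟨s, hs⟩ := y.2
    refine ⟨⟨s * a, s, rfl⟩, ?_⟩
    rw [LeftCat.val_homOf, hs, mul_assoc, h1]
  have h3 := hat_mul_eq (LeftCat.principalCone a ha) (LeftCat.principalCone b hb)
    (LeftCat.homOf ha hab (a * b) h1 hab) (LeftCat.homOf hab hb (a * b) hab h2)
    (fun x => (LeftCat.mem_of hab).1 x.2) (LeftCat.hom_ext fun x => by
      change (x : S) * b = x * (a * b) * (a * b)
      rw [mul_assoc, hab, ← mul_assoc, (LeftCat.mem_of ha).1 x.2])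
  refine h3.trans (LeftCat.hat_ext rfl fun I x => ?_)
  change (x : S) * a * (a * b) = x * (a * b)
  rw [mul_assoc, h1]

lemma principal_idem (a : S) : IsIdempotentElem (principal a) := by
  change principal a * principal a = principal a
  rw [principal_mul, idem]

lemma principal_le_iff {a b : S} : principal a ≤ principal b ↔ b * a = a := by
  rw [idem_le_iff (principal_idem b), principal_mul]
  exact ⟨fun h => principal_injective h, fun h => congrArg principal h⟩

/-- Every cone below a principal cone is principal. -/
lemma eq_principal_of_le {γ : Hat (LeftCat S)} {b : S} (h : γ ≤ principal b) :
    ∃ a : S, γ = principal a := by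
  obtain ⟨⟨y, δ⟩, rfl⟩ := h
  obtain ⟨z, p, j, hp, hj, -, e⟩ := hat_mul_exists (LeftCat.principalCone b (idem b)) δ
  obtain ⟨f, hf, rfl⟩ := z.exists_of
  obtain ⟨a, h1, h2, hm⟩ := LeftCat.hom_form p
  have hval : ∀ I x, LeftCat.val (((LeftCat.principalCone b (idem b)).star p).app I) x = x * a := by
    intro I x
    change LeftCat.val p ⟨x * b, _⟩ = x * a
    rw [hm, mul_assoc, h1]
  refine ⟨a, e.trans (LeftCat.hat_ext ?_ hval)⟩
  ext x
  change x ∈ leftIdeal f ↔ x ∈ leftIdeal a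
  constructor
  · rintro ⟨s, rfl⟩
    obtain ⟨I, hI⟩ := ((LeftCat.principalCone b (idem b)).star p).exists_iso
    obtain ⟨y, hy⟩ := LeftCat.surj_of_isIso
      (((LeftCat.principalCone b (idem b)).star p).app I) ⟨f, f, hf.symm⟩
    rw [hval] at hy
    exact ⟨s * y, by rw [mul_assoc, hy]⟩
  · rintro ⟨s, rfl⟩
    exact ⟨s * a, by rw [mul_assoc, h2]⟩

variable (S) in
/-- The down-set of the `ℛ`-classes of the principal cones. -/
def principalClasses : LowerSet (RPoset (LeftCat S)) where
  carrier := {d | ∃ e : S, d = rClass (principal e)}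
  lower' := by
    rintro _ d hd ⟨b, rfl⟩
    induction d using Antisymmetrization.ind with
    | _ γ =>
      obtain ⟨a, rfl⟩ := eq_principal_of_le (toAntisymmetrization_le_toAntisymmetrization_iff.1 hd)
      exact ⟨a, rfl⟩

lemma idemCone_eq {c : LeftCat S} {d : RPoset (LeftCat S)} {ε : Cone (LeftCat S) c}
    (h : IsIdemCone d ε) (hd : d ∈ principalClasses S) :
    (⟨c, ε⟩ : Hat (LeftCat S)) = principal (LeftCat.gen c) := by
  obtain ⟨b, rfl⟩ := hd
  obtain ⟨a, ha⟩ := eq_principal_of_le (Quotient.exact h.2).1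
  have h1 : c = LeftCat.of a (idem a) := congrArg Hat.vertex ha
  rw [ha, h1, gen_of]

lemma idemCone_val {c : LeftCat S} {d : RPoset (LeftCat S)} {ε : Cone (LeftCat S) c}
    (h : IsIdemCone d ε) (hd : d ∈ principalClasses S) (I : LeftCat S) (x : I.carrier) :
    LeftCat.val (ε.app I) x = x * LeftCat.gen c := by
  have h1 := idemCone_eq h hd
  have : ∀ γ : Hat (LeftCat S), γ = principal (LeftCat.gen c) →
      LeftCat.val (γ.cone.app I) x = x * LeftCat.gen c := by
    rintro _ rfl; rfl
  exact this _ h1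

lemma connectedBy_eq {c : LeftCat S} {d : RPoset (LeftCat S)} (h : ConnectedBy c d)
    (hd : d ∈ principalClasses S) : d = rClass (principal (LeftCat.gen c)) := by
  obtain ⟨ε, hε⟩ := h
  rw [← idemCone_eq hε hd]
  exact hε.2.symm

variable (S) in
/-- The category of principal left ideals of a right regular band, connected by the `ℛ`-classes of
the principal cones, as a supported category. -/
def leftObj : SC.{u} where
  obj :=
    { carrier := LeftCat S
      D := principalClasses S
      connected := fun c => by
        obtain ⟨e, he, rfl⟩ := c.exists_of
        exact ⟨_, ⟨e, rfl⟩, LeftCat.principalCone e he, principal_idem e, rfl⟩ }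
  property c := by
    obtain ⟨e, he, rfl⟩ := LeftCat.exists_of c
    refine ⟨rClass (principal e),
      ⟨⟨e, rfl⟩, LeftCat.principalCone e he, principal_idem e, rfl⟩, ?_⟩
    rintro d ⟨hd, hc⟩
    rw [connectedBy_eq hc hd, gen_of]

end

section

variable {S T : Type u} [Semigroup S] [Semigroup T] [IsRightRegularBand T]

open IsRightRegularBand

lemma map_gen (φ : S →ₙ* T) (I : LeftCat S) :
    φ (LeftCat.gen I) * φ (LeftCat.gen I) = φ (LeftCat.gen I) := idem _

/-- The functor `S e ↦ T (φ e)`, `r(e, u, f) ↦ r(φ e, φ u, φ f)`. -/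
noncomputable def leftMapF (φ : S →ₙ* T) : LeftCat S ⥤ LeftCat T where
  obj I := LeftCat.of (φ (LeftCat.gen I)) (map_gen φ I)
  map {I J} m := LeftCat.homOf (map_gen φ I) (map_gen φ J)
    (φ (LeftCat.val m ⟨LeftCat.gen I, LeftCat.gen_mem I⟩))
    (by rw [← map_mul, LeftCat.val_gen_mul]) (by rw [← map_mul, LeftCat.val_mul_gen])
  map_id I := LeftCat.hom_ext fun x => (LeftCat.mem_of (map_gen φ I)).1 x.2
  map_comp {I J K} m n := LeftCat.hom_ext fun x => by
    change (x : T) * φ (LeftCat.val (m ≫ n) _) = x * φ (LeftCat.val m _) * φ (LeftCat.val n _)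
    rw [LeftCat.val_comp, LeftCat.val_eq_gen n, map_mul, ← mul_assoc]
    rfl

lemma val_leftMapF (φ : S →ₙ* T) {I J : LeftCat S} (m : I ⟶ J)
    (y : ((leftMapF φ).obj I).carrier) : LeftCat.val ((leftMapF φ).map m) y =
      y * φ (LeftCat.val m ⟨LeftCat.gen I, LeftCat.gen_mem I⟩) := rfl

lemma gen_leftMapF (φ : S →ₙ* T) (I : LeftCat S) :
    LeftCat.gen ((leftMapF φ).obj I) = φ (LeftCat.gen I) := gen_of _ (map_gen φ I)

variable [IsRightRegularBand S]

/-- The order preserving map taking the class of `r^e` to the class of `r^(φ e)`. -/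
noncomputable def leftMapG (φ : S →ₙ* T) : principalClasses S →o principalClasses T where
  toFun d := ⟨rClass (principal (φ d.2.choose)), _, rfl⟩
  monotone' d d' h := by
    have h' : d.1 ≤ d'.1 := h
    rw [d.2.choose_spec, d'.2.choose_spec, toAntisymmetrization_le_toAntisymmetrization_iff,
      principal_le_iff] at h'
    change rClass _ ≤ rClass _
    rw [toAntisymmetrization_le_toAntisymmetrization_iff, principal_le_iff, ← map_mul, h']

lemma leftMapG_eq (φ : S →ₙ* T) (e : S) (h : rClass (principal e) ∈ principalClasses S) :
    (leftMapG φ ⟨rClass (principal e), h⟩).1 = rClass (principal (φ e)) := by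
  have h1 := Quotient.exact h.choose_spec
  have h2 : h.choose * e = e := principal_le_iff.1 h1.1
  have h3 : e * h.choose = h.choose := principal_le_iff.1 h1.2
  refine Quotient.sound ⟨principal_le_iff.2 ?_, principal_le_iff.2 ?_⟩
  · rw [← map_mul, h3]
  · rw [← map_mul, h2]

lemma leftMapF_id : leftMapF (MulHom.id S) = 𝟭 (LeftCat S) := by
  refine CategoryTheory.Functor.ext (fun I => LeftCat.of_gen I) fun I J m => LeftCat.hom_ext fun x => ?_
  rw [LeftCat.val_comp, LeftCat.val_comp, LeftCat.val_eqToHom]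
  change _ = LeftCat.val m _
  rw [LeftCat.val_eq_gen m]
  exact congrArg (· * _) (LeftCat.val_eqToHom _ x).symm

lemma leftMapF_comp {R : Type u} [Semigroup R] [IsRightRegularBand R] (φ : S →ₙ* T)
    (ψ : T →ₙ* R) : leftMapF (ψ.comp φ) = leftMapF φ ⋙ leftMapF ψ := by
  have h : ∀ I, (leftMapF (ψ.comp φ)).obj I = (leftMapF φ ⋙ leftMapF ψ).obj I := fun I =>
    LeftCat.ext (congrArg leftIdeal (congrArg ψ (gen_leftMapF φ I)).symm)
  refine CategoryTheory.Functor.ext h fun I J m => LeftCat.hom_ext fun x => ?_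
  rw [LeftCat.val_comp, LeftCat.val_comp, LeftCat.val_eqToHom]
  change x * ψ (φ _) = LeftCat.val ((leftMapF ψ).map ((leftMapF φ).map m)) _
  have hx : (LeftCat.Hom.toFun (eqToHom (h I)) x : R) = x := LeftCat.val_eqToHom (h I) x
  have hxI : x * ψ (LeftCat.gen ((leftMapF φ).obj I)) = x := by
    rw [gen_leftMapF]
    exact (LeftCat.mem_of (map_gen (ψ.comp φ) I)).1 x.2
  rw [val_leftMapF, val_leftMapF, map_mul, ← mul_assoc, hx]
  exact congrArg (· * _) hxI.symm

lemma leftMapG_id : leftMapG (MulHom.id S) = OrderHom.id := by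
  refine OrderHom.ext _ _ (funext fun d => ?_)
  obtain ⟨_, e, rfl⟩ := d
  exact Subtype.ext (leftMapG_eq (MulHom.id S) e _)

lemma leftMapG_comp {R : Type u} [Semigroup R] [IsRightRegularBand R] (φ : S →ₙ* T)
    (ψ : T →ₙ* R) : leftMapG (ψ.comp φ) = (leftMapG ψ).comp (leftMapG φ) := by
  refine OrderHom.ext _ _ (funext fun d => ?_)
  obtain ⟨_, e, rfl⟩ := d
  refine Subtype.ext ((leftMapG_eq (ψ.comp φ) e _).trans ?_)
  have hm : rClass (principal (φ e)) ∈ principalClasses T := ⟨φ e, rfl⟩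
  have h : leftMapG φ ⟨rClass (principal e), e, rfl⟩ = ⟨rClass (principal (φ e)), hm⟩ :=
    Subtype.ext (leftMapG_eq φ e _)
  change _ = (leftMapG ψ (leftMapG φ _)).1
  rw [h, leftMapG_eq ψ (φ e) hm]
  rfl

/-- The SC-morphism induced by a homomorphism of right regular bands. -/
noncomputable def leftMap (φ : S →ₙ* T) : CC.Hom (leftObj S).obj (leftObj T).obj where
  F := leftMapF φ
  G := leftMapG φ
  map_incl {I J} m hm := fun y => by
    have h : LeftCat.val m ⟨LeftCat.gen I, LeftCat.gen_mem I⟩ = LeftCat.gen I := hm _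
    refine (val_leftMapF φ m y).trans ?_
    rw [h]
    exact (LeftCat.mem_of (map_gen φ I)).1 y.2
  map_connected c d h := by
    obtain ⟨d, hd⟩ := d
    obtain rfl := connectedBy_eq h hd
    exact ⟨LeftCat.principalCone (φ (LeftCat.gen c)) (map_gen φ c), principal_idem _,
      (leftMapG_eq φ _ hd).symm⟩
  map_cone c d ε ε' h h' I := by
    refine LeftCat.hom_ext fun y => ?_
    refine (val_leftMapF φ _ y).trans (Eq.trans ?_ (idemCone_val h' (leftMapG φ d).2 _ y).symm)
    have h1 := idemCone_val h d.2 I ⟨LeftCat.gen I, LeftCat.gen_mem I⟩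
    rw [h1, map_mul, ← mul_assoc, (LeftCat.mem_of (map_gen φ I)).1 y.2]
    exact congrArg _ (gen_leftMapF φ c).symm

end

instance (B : RRB.{u}) : IsRightRegularBand B.obj := B.property

/-- The functor from right regular bands to supported categories, taking a band to the category of
its principal left ideals connected by the `ℛ`-classes of the principal cones. -/
noncomputable def leftFunctor : RRB.{u} ⥤ SC.{u} where
  obj B := leftObj B.obj
  map φ := ObjectProperty.homMk (leftMap φ.hom.hom)
  map_id _ := ObjectProperty.hom_ext _ (CC.Hom.ext leftMapF_id leftMapG_id)
  map_comp φ ψ := ObjectProperty.hom_ext _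
    (CC.Hom.ext (leftMapF_comp φ.hom.hom ψ.hom.hom) (leftMapG_comp φ.hom.hom ψ.hom.hom))

/-- The map `b ↦ r^b` from a right regular band to the band of idempotent cones of its category of
principal left ideals. -/
noncomputable def rhoBar (B : RRB.{u}) : B ⟶ idemFunctor.obj (leftFunctor.obj B) :=
  ObjectProperty.homMk (Semigrp.ofHom
    { toFun := fun b => (⟨⟨principal b, b, rfl⟩, Subtype.ext (principal_idem b)⟩ :
        IdemCones (leftObj B.obj))
      map_mul' := fun a b => Subtype.ext (Subtype.ext (principal_mul a b).symm) })

/-- The category `C` is coreflective in `D`: it is equivalent to a full subcategory of `D` whose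
inclusion functor has a right adjoint. -/
def IsCoreflectiveIn (C D : Type (u + 1)) [Category.{u} C] [Category.{u} D] : Prop :=
  ∃ P : ObjectProperty D, P.ι.IsLeftAdjoint ∧ Nonempty (C ≌ P.FullSubcategory)

end CrossConn

namespace CrossConn

/-! A homomorphism `φ` from a right regular band `B` to the connection semigroup of `X` determines
an inclusion preserving functor from the principal left ideals of `B` to `X`: it takes `B e` to the
vertex of `φ e` and the morphism `r(e, u, f)` to the morphism `υ(z_ε) ≫ j(z_υ, z_φ)`, where
`ε, υ, φ` are the images of `e, u, f`. With `r^b ↦ φ b` on `ℛ`-classes this is a morphism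
`C(B) ⟶ X` that takes `r^b` to `φ b`. It is the only one, since `r(e, u, f)` is itself of the form
`r^u(B e) ≫ j(B u, B f)` and morphisms of supported categories preserve idempotent cones. Hence
`b ↦ r^b` is a universal arrow from `B` to the functor of idempotent cones. As it is an isomorphism,
the left adjoint is fully faithful, and its essential image is the required coreflective
subcategory. Left regular bands are the opposites of right regular ones. -/

section Cones

variable {C : Type u} [SmallCategory C] [SubobjectCategory C] [NormalCategory C]

lemma exists_incl_mul_app (γ δ : Hat C) :
    ∃ j : (γ * δ).vertex ⟶ δ.vertex, IsIncl j ∧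
      ∀ c, (γ * δ).cone.app c ≫ j = γ.cone.app c ≫ δ.cone.app γ.vertex := by
  let n := normalFac (δ.cone.app γ.vertex)
  refine ⟨n.j, n.j_incl, fun c => ?_⟩
  change (γ.cone.app c ≫ n.q ≫ n.v) ≫ n.j = _
  simp only [Category.assoc, ← n.fac]

lemma isIncl_app_of_mul_eq {γ δ : Hat C} (h : γ * δ = γ) : IsIncl (δ.cone.app γ.vertex) := by
  have hγδ := exists_incl_mul_app γ δ
  rw [h] at hγδ
  obtain ⟨j, hj, hcomp⟩ := hγδ
  obtain ⟨c, _⟩ := γ.cone.exists_iso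
  rwa [← (cancel_epi (γ.cone.app c)).1 (hcomp c)]

lemma app_vertex_of_idem {ε : Hat C} (hε : IsIdempotentElem ε) :
    ε.cone.app ε.vertex = 𝟙 ε.vertex :=
  (idem_app ε.cone).1 hε

lemma app_eq_of_isIncl {ε : Hat C} (hε : IsIdempotentElem ε) {a : C} (j : a ⟶ ε.vertex)
    (hj : IsIncl j) : ε.cone.app a = j := by
  rw [← ε.cone.w j hj, app_vertex_of_idem hε, Category.comp_id]

/-- The morphism `υ(z_ε) ≫ φ(z_υ)` between the vertices of `ε` and `φ`. If `φ` is idempotent and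
`υ φ = υ`, its second factor is the inclusion of `z_υ` in `z_φ`. It is the counterpart for cones of
the morphism `r(e, u, f)` between principal left ideals. -/
def vertexHom (ε υ φ : Hat C) : ε.vertex ⟶ φ.vertex :=
  υ.cone.app ε.vertex ≫ φ.cone.app υ.vertex

lemma vertexHom_self_left {ε : Hat C} (hε : IsIdempotentElem ε) (φ : Hat C) :
    vertexHom ε ε φ = φ.cone.app ε.vertex := by
  rw [vertexHom, app_vertex_of_idem hε, Category.id_comp]

lemma vertexHom_mul {ε φ : Hat C} (hε : IsIdempotentElem ε) (hφ : IsIdempotentElem φ) :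
    vertexHom ε (ε * φ) φ = φ.cone.app ε.vertex := by
  obtain ⟨j, hj, hcomp⟩ := exists_incl_mul_app ε φ
  rw [vertexHom, app_eq_of_isIncl hφ j hj, hcomp, app_vertex_of_idem hε, Category.id_comp]

lemma vertexHom_comp {ε υ φ ν ψ : Hat C} (h : υ * φ = υ) :
    vertexHom ε υ φ ≫ vertexHom φ ν ψ = vertexHom ε (υ * ν) ψ := by
  obtain ⟨j, hj, hcomp⟩ := exists_incl_mul_app υ ν
  calc vertexHom ε υ φ ≫ vertexHom φ ν ψ
      = υ.cone.app ε.vertex ≫ (φ.cone.app υ.vertex ≫ ν.cone.app φ.vertex) ≫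
          ψ.cone.app ν.vertex := by simp only [vertexHom, Category.assoc]
    _ = (υ.cone.app ε.vertex ≫ ν.cone.app υ.vertex) ≫ ψ.cone.app ν.vertex := by
      rw [ν.cone.w _ (isIncl_app_of_mul_eq h), Category.assoc]
    _ = (υ * ν).cone.app ε.vertex ≫ j ≫ ψ.cone.app ν.vertex := by
      rw [← hcomp, Category.assoc]
    _ = vertexHom ε (υ * ν) ψ := by rw [ψ.cone.w j hj, vertexHom]

end Cones

section VertexFunctor

variable {S : Type u} [Semigroup S] {C : Type u} [SmallCategory C] [SubobjectCategory C]
  [NormalCategory C]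

lemma LeftCat.val_comp_gen {I J K : LeftCat S} (m : I ⟶ J) (n : J ⟶ K) :
    val (m ≫ n) ⟨gen I, gen_mem I⟩ = val m ⟨gen I, gen_mem I⟩ * val n ⟨gen J, gen_mem J⟩ :=
  val_eq_gen n _

lemma isIdempotentElem_map_gen (ψ : S →ₙ* Hat C) (I : LeftCat S) :
    IsIdempotentElem (ψ (LeftCat.gen I)) :=
  IsIdempotentElem.map (LeftCat.gen_idem I) ψ

/-- The functor `S e ↦ z_{ψ e}` from the principal left ideals of `S` to `C` induced by a
homomorphism `ψ` to the semigroup of cones; it takes `r(e, u, f)` to the morphism represented by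
`ψ u`. The generators `e` and `f` are chosen. -/
noncomputable def vertexFunctor (ψ : S →ₙ* Hat C) : LeftCat S ⥤ C where
  obj I := (ψ (LeftCat.gen I)).vertex
  map {I J} m := vertexHom (ψ (LeftCat.gen I))
    (ψ (LeftCat.val m ⟨LeftCat.gen I, LeftCat.gen_mem I⟩)) (ψ (LeftCat.gen J))
  map_id I := (vertexHom_self_left (isIdempotentElem_map_gen ψ I) _).trans
    (app_vertex_of_idem (isIdempotentElem_map_gen ψ I))
  map_comp {I J K} m n := by
    rw [LeftCat.val_comp_gen, map_mul,
      vertexHom_comp (by rw [← map_mul, LeftCat.val_mul_gen])]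

lemma vertexFunctor_map_isIncl (ψ : S →ₙ* Hat C) {I J : LeftCat S} (j : I ⟶ J) (hj : IsIncl j) :
    IsIncl ((vertexFunctor ψ).map j) := by
  have hval : LeftCat.val j ⟨LeftCat.gen I, LeftCat.gen_mem I⟩ = LeftCat.gen I := hj _
  have hmul : ψ (LeftCat.gen I) * ψ (LeftCat.gen J) = ψ (LeftCat.gen I) := by
    rw [← map_mul, ← hval, LeftCat.val_mul_gen]
  change IsIncl (vertexHom _ _ _)
  rw [hval, vertexHom_self_left (isIdempotentElem_map_gen ψ I)]
  exact isIncl_app_of_mul_eq hmul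

lemma vertexFunctor_map_eq_app (ψ : S →ₙ* Hat C) {I J : LeftCat S} (m : I ⟶ J)
    (hm : LeftCat.val m ⟨LeftCat.gen I, LeftCat.gen_mem I⟩ = LeftCat.gen I * LeftCat.gen J) :
    (vertexFunctor ψ).map m = (ψ (LeftCat.gen J)).cone.app (ψ (LeftCat.gen I)).vertex := by
  change vertexHom _ _ _ = _
  rw [hm, map_mul,
    vertexHom_mul (isIdempotentElem_map_gen ψ I) (isIdempotentElem_map_gen ψ J)]

end VertexFunctor

section Lift

variable {S : Type u} [Semigroup S] [IsRightRegularBand S]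

/-- The order preserving map `R_{r^e} ↦ f e` induced by a map `f` that is monotone for the order
`a ≤ b ↔ b a = a` of the band; the representative `e` of a class is chosen. -/
noncomputable def principalClassesLift {P : Type*} [Preorder P] (f : S → P)
    (hf : ∀ a b : S, b * a = a → f a ≤ f b) : principalClasses S →o P where
  toFun d := f d.2.choose
  monotone' d d' hdd' := by
    have hle : d.1 ≤ d'.1 := hdd'
    rw [d.2.choose_spec, d'.2.choose_spec, toAntisymmetrization_le_toAntisymmetrization_iff,
      principal_le_iff] at hle
    exact hf _ _ hle

lemma principalClassesLift_rClass {P : Type*} [PartialOrder P] (f : S → P)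
    (hf : ∀ a b : S, b * a = a → f a ≤ f b) (e : S)
    (he : rClass (principal e) ∈ principalClasses S) :
    principalClassesLift f hf ⟨rClass (principal e), he⟩ = f e := by
  obtain ⟨hle, hge⟩ := Quotient.exact he.choose_spec
  exact le_antisymm (hf _ _ (principal_le_iff.1 hge)) (hf _ _ (principal_le_iff.1 hle))

variable {X : CC.{u}} (φ : S →ₙ* X.connectionSemigroup)

/-- The order preserving map `R_{r^e} ↦ R_{φ e}`. -/
noncomputable def liftG : principalClasses S →o X.D :=
  principalClassesLift (fun e => ⟨rClass (φ e).1, (φ e).2⟩) fun a b hab =>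
    toAntisymmetrization_le_toAntisymmetrization_iff.2
      ⟨(φ a).1, congrArg Subtype.val ((congrArg φ hab).symm.trans (map_mul φ b a))⟩

lemma liftG_rClass (e : S) (he : rClass (principal e) ∈ principalClasses S) :
    (liftG φ ⟨rClass (principal e), he⟩).1 = rClass (φ e).1 :=
  congrArg Subtype.val (principalClassesLift_rClass _ _ e he)

lemma isIdemCone_liftG {c : LeftCat S} {d : principalClasses S} (h : ConnectedBy c d.1) :
    IsIdemCone (liftG φ d).1 (φ (LeftCat.gen c)).1.cone := by
  obtain ⟨d, hd⟩ := d
  obtain rfl := connectedBy_eq h hd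
  exact ⟨isIdempotentElem_map_gen ((MulMemClass.subtype X.connectionSemigroup).comp φ) c,
    (liftG_rClass φ _ hd).symm⟩

/-- The CC-morphism from the category of principal left ideals of `S` to `X` induced by a
homomorphism from `S` to the connection semigroup of `X`. -/
noncomputable def liftHom : CC.Hom (leftObj S).obj X where
  F := vertexFunctor ((MulMemClass.subtype X.connectionSemigroup).comp φ)
  G := liftG φ
  map_incl j hj := vertexFunctor_map_isIncl _ j hj
  map_connected _ _ h := ⟨_, isIdemCone_liftG φ h⟩
  map_cone c d ε ε' h h' I := by
    obtain rfl := h'.unique (isIdemCone_liftG φ ⟨ε, h⟩)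
    exact vertexFunctor_map_eq_app _ _ (idemCone_val h d.2 I _)

end Lift

section Universal

lemma scHom_map_vertexHom {X Y : SC.{u}} (m : X ⟶ Y) (ε υ φ : IdemCones X) :
    (scHom m).F.map (vertexHom ε.1.1 υ.1.1 φ.1.1) =
      vertexHom (idemMap m ε).1.1 (idemMap m υ).1.1 (idemMap m φ).1.1 :=
  ((scHom m).F.map_comp _ _).trans
    (congr (congrArg CategoryStruct.comp (idemMap_app m υ _)) (idemMap_app m φ _))

variable {S : Type u} [Semigroup S] [IsRightRegularBand S]

lemma exists_eq_vertexHom_principal {e f : S} {he : e * e = e} {hf : f * f = f}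
    (m : LeftCat.of e he ⟶ LeftCat.of f hf) :
    ∃ u, m = vertexHom (principal e) (principal u) (principal f) := by
  obtain ⟨u, -, huf, hm⟩ := LeftCat.hom_form m
  refine ⟨u, LeftCat.hom_ext fun x => ?_⟩
  change _ = (x : S) * u * f
  rw [hm, mul_assoc, huf]

/-- The principal cone `r^b` as an element of the band of idempotent cones. -/
def principalIdem (b : S) : IdemCones (leftObj S) :=
  ⟨⟨principal b, b, rfl⟩, Subtype.ext (principal_idem b)⟩

lemma principalIdem_bijective : Function.Bijective (principalIdem (S := S)) :=
  ⟨fun _ _ h => principal_injective (congrArg (fun γ => γ.1.1) h), fun γ =>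
    ⟨LeftCat.gen γ.1.1.vertex, IdemCones.ext (LeftCat.of_gen γ.1.1.vertex)⟩⟩

lemma leftObj_hom_ext {X : SC.{u}} {m n : leftObj S ⟶ X}
    (h : ∀ b : S, idemMap m (principalIdem b) = idemMap n (principalIdem b)) : m = n := by
  refine ObjectProperty.hom_ext _ (CC.Hom.ext (Functor.hext (fun I => ?_) fun I J k => ?_)
    (OrderHom.ext _ _ (funext fun ⟨_, e, hd⟩ => Subtype.ext ?_)))
  · obtain ⟨e, he, rfl⟩ := LeftCat.exists_of I
    exact congrArg (fun γ => γ.1.1.vertex) (h e)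
  · obtain ⟨e, he, rfl⟩ := LeftCat.exists_of I
    obtain ⟨f, hf, rfl⟩ := LeftCat.exists_of J
    obtain ⟨u, rfl⟩ := exists_eq_vertexHom_principal k
    have hm := scHom_map_vertexHom m (principalIdem e) (principalIdem u) (principalIdem f)
    have hn := scHom_map_vertexHom n (principalIdem e) (principalIdem u) (principalIdem f)
    have hmn : HEq
        (vertexHom (idemMap m (principalIdem e)).1.1 (idemMap m (principalIdem u)).1.1
          (idemMap m (principalIdem f)).1.1)
        (vertexHom (idemMap n (principalIdem e)).1.1 (idemMap n (principalIdem u)).1.1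
          (idemMap n (principalIdem f)).1.1) := by rw [h e, h u, h f]
    exact (heq_of_eq hm).trans (hmn.trans (heq_of_eq hn).symm)
  · subst hd
    have hm := (idemMap_isIdemCone m (principalIdem e)).2
    have hn := (idemMap_isIdemCone n (principalIdem e)).2
    rw [h e] at hm
    exact hm.symm.trans hn

/-- The inclusion of the band of idempotent cones in the connection semigroup. -/
def IdemCones.val {X : SC.{u}} : IdemCones X →ₙ* X.obj.connectionSemigroup where
  toFun := Subtype.val
  map_mul' _ _ := rfl

lemma idemMap_liftHom_principalIdem {X : SC.{u}} (φ : S →ₙ* IdemCones X) (b : S) :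
    idemMap (ObjectProperty.homMk (liftHom (IdemCones.val.comp φ)) : leftObj S ⟶ X)
      (principalIdem b) = φ b :=
  IdemCones.ext (congrArg (fun a => (φ a).1.1.vertex) (gen_of b (IsRightRegularBand.idem b)))

end Universal

section Adjunction

lemma rhoBar_comp_map_bijective (B : RRB.{u}) (X : SC.{u}) :
    Function.Bijective fun m : leftFunctor.obj B ⟶ X => rhoBar B ≫ idemFunctor.map m :=
  ⟨fun _ _ h => leftObj_hom_ext fun b => congrArg (fun g => g.hom.hom b) h, fun φ =>
    ⟨ObjectProperty.homMk (liftHom (IdemCones.val.comp φ.hom.hom)),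
      ObjectProperty.hom_ext _ (Semigrp.ext (idemMap_liftHom_principalIdem φ.hom.hom))⟩⟩

/-- The unit `b ↦ r^b` as a natural transformation. -/
noncomputable def rhoBarNatTrans : 𝟭 RRB.{u} ⟶ leftFunctor ⋙ idemFunctor where
  app := rhoBar
  naturality _ B φ := ObjectProperty.hom_ext _ <| Semigrp.ext fun a =>
    IdemCones.ext (X := leftObj B.obj) <| LeftCat.ext <|
      congrArg (fun b => leftIdeal (φ.hom.hom b)) (gen_of a (IsRightRegularBand.idem a)).symm

/-- The adjunction whose unit is a given natural transformation consisting of universal arrows. -/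
noncomputable def adjunctionOfUnit {C D : Type*} [Category* C] [Category* D] {L : C ⥤ D}
    {R : D ⥤ C} (η : 𝟭 C ⟶ L ⋙ R)
    (hη : ∀ B X, Function.Bijective fun m : L.obj B ⟶ X => η.app B ≫ R.map m) : L ⊣ R :=
  Adjunction.mkOfHomEquiv
    { homEquiv := fun B X => Equiv.ofBijective _ (hη B X)
      homEquiv_naturality_left_symm := fun {A B X} f g => by
        obtain ⟨m, rfl⟩ := (Equiv.ofBijective _ (hη B X)).surjective g
        rw [Equiv.symm_apply_apply, Equiv.symm_apply_eq]
        simpa using η.naturality_assoc f (R.map m)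
      homEquiv_naturality_right := fun f g => by simp }

/-- The functor of principal left ideals is left adjoint to the functor of idempotent cones. -/
noncomputable def leftIdemAdjunction : leftFunctor.{u} ⊣ idemFunctor.{u} :=
  adjunctionOfUnit rhoBarNatTrans rhoBar_comp_map_bijective

lemma leftIdemAdjunction_unit_app (B : RRB.{u}) :
    leftIdemAdjunction.unit.app B = rhoBar B := by
  simp [leftIdemAdjunction, adjunctionOfUnit, rhoBarNatTrans]

lemma isIso_rhoBar (B : RRB.{u}) : IsIso (rhoBar B) :=
  let e : B.obj ≃* IdemCones (leftObj B.obj) :=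
    MulEquiv.ofBijective (rhoBar B).hom.hom principalIdem_bijective
  let i : B ≅ idemFunctor.obj (leftFunctor.obj B) := ObjectProperty.isoMk _ e.toSemigrpIso
  i.isIso_hom

end Adjunction

section Coreflective

lemma isCoreflectiveIn_of_isIso_unit {C D : Type (u + 1)} [Category.{u} C] [Category.{u} D]
    {L : C ⥤ D} {R : D ⥤ C} (adj : L ⊣ R) [IsIso adj.unit] : IsCoreflectiveIn C D := by
  have : L.Full := adj.fullyFaithfulLOfIsIsoUnit.full
  have : L.Faithful := adj.fullyFaithfulLOfIsIsoUnit.faithful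
  have : L.IsLeftAdjoint := adj.isLeftAdjoint
  have : (L.toEssImage ⋙ L.essImage.ι).IsLeftAdjoint :=
    Functor.isLeftAdjoint_of_iso L.toEssImageCompι.symm
  exact ⟨L.essImage, (Functor.isLeftAdjoint_comp_iff_right L.toEssImage _).1 this,
    ⟨L.toEssImage.asEquivalence⟩⟩

lemma IsCoreflectiveIn.of_equivalence {C C' D : Type (u + 1)} [Category.{u} C] [Category.{u} C']
    [Category.{u} D] (h : IsCoreflectiveIn C' D) (e : C ≌ C') : IsCoreflectiveIn C D := by
  obtain ⟨P, hP, ⟨e'⟩⟩ := h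
  exact ⟨P, hP, ⟨e.trans e'⟩⟩

lemma isCoreflectiveIn_RRB_SC : IsCoreflectiveIn RRB.{u} SC.{u} := by
  have (B : RRB.{u}) : IsIso (leftIdemAdjunction.unit.app B) := by
    rw [leftIdemAdjunction_unit_app]
    exact isIso_rhoBar B
  have : IsIso leftIdemAdjunction.{u}.unit := NatIso.isIso_of_isIso_app _
  exact isCoreflectiveIn_of_isIso_unit leftIdemAdjunction

end Coreflective

section LeftRegular

instance (S : Type u) [Semigroup S] [IsLeftRegularBand S] : IsRightRegularBand Sᵐᵒᵖ where
  idem e := MulOpposite.unop_injective (IsLeftRegularBand.idem e.unop)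
  reg e f := MulOpposite.unop_injective <| by
    simpa [mul_assoc] using IsLeftRegularBand.reg e.unop f.unop

instance (S : Type u) [Semigroup S] [IsRightRegularBand S] : IsLeftRegularBand Sᵐᵒᵖ where
  idem e := MulOpposite.unop_injective (IsRightRegularBand.idem e.unop)
  reg e f := MulOpposite.unop_injective <| by
    simpa [mul_assoc] using IsRightRegularBand.reg e.unop f.unop

instance (B : LRB.{u}) : IsLeftRegularBand B.obj := B.property

/-- Taking the opposite band is an equivalence of left regular with right regular bands. -/
def lrbEquivRRB : LRB.{u} ≌ RRB.{u} where
  functor :=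
    { obj := fun B => ⟨Semigrp.of B.objᵐᵒᵖ, inferInstanceAs (IsRightRegularBand B.objᵐᵒᵖ)⟩
      map := fun φ => ObjectProperty.homMk (Semigrp.ofHom (MulHom.op φ.hom.hom)) }
  inverse :=
    { obj := fun B => ⟨Semigrp.of B.objᵐᵒᵖ, inferInstanceAs (IsLeftRegularBand B.objᵐᵒᵖ)⟩
      map := fun φ => ObjectProperty.homMk (Semigrp.ofHom (MulHom.op φ.hom.hom)) }
  unitIso := NatIso.ofComponents fun B =>
    ObjectProperty.isoMk _ (MulEquiv.opOp B.obj).toSemigrpIso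
  counitIso := NatIso.ofComponents fun B =>
    ObjectProperty.isoMk _ (MulEquiv.opOp B.obj).symm.toSemigrpIso

end LeftRegular

end CrossConn

theorem mainTheorem7 :
    (∃ adj : CrossConn.leftFunctor.{u} ⊣ CrossConn.idemFunctor.{u},
      ∀ B : CrossConn.RRB.{u}, adj.unit.app B = CrossConn.rhoBar B) ∧
    CrossConn.IsCoreflectiveIn CrossConn.RRB.{u} CrossConn.SC.{u} ∧
    CrossConn.IsCoreflectiveIn CrossConn.LRB.{u} CrossConn.SC.{u} :=
  ⟨⟨CrossConn.leftIdemAdjunction, CrossConn.leftIdemAdjunction_unit_app⟩,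
    CrossConn.isCoreflectiveIn_RRB_SC,
    CrossConn.isCoreflectiveIn_RRB_SC.of_equivalence CrossConn.lrbEquivRRB⟩
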